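/- Let $(M,\omega)$ be a closed (compact, without boundary) connected symplectic manifold of dimension $2n$ with $n\ge 3$, i.e. $\omega$ is a smooth, closed, non-degenerate differential $2$-form on the smooth manifold $M$. For $1\le k\le n$ let $\omega^k=\omega\wedge\dots\wedge\omega$ ($k$ factors), let $\mathrm{Diff}(M,\omega^k)$ be the group of all smooth diffeomorphisms $f:M\to M$ with $f^*\omega^k=\omega^k$, and let $\mathrm{Diff}_0(M,\omega^k)$ be its identity component, that is, the subgroup of all $f$ for which there is a family $(f_t)_{0\le t\le 1}$ in $\mathrm{Diff}(M,\omega^k)$ with $f_0=\mathrm{id}$, $f_1=f$ and $(t,x)\mapsto f_t(x)$ smooth on $[0,1]\times M$. Let $\mathrm{Symp}(M,\omega)$ be the group of all smooth diffeomorphisms $f$ of $M$ with $f^*\omega=\omega$, and $\mathrm{Symp}_0(M,\omega)$ its identity component in the same sense. Then $$\mathrm{Diff}_0(M,\omega^k)=\mathrm{Symp}_0(M,\omega)\qquad\text{for all } 0<k<n.$$ -/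

import Mathlib

open Set
open scoped Manifold ContDiff

noncomputable section

namespace SymplecticPower

section Linear

variable {V : Type*} [AddCommGroup V] [Module ℝ V]

/-- The wedge product of real-valued alternating forms, as a sum over shuffles
(so that `(dx ∧ dy) (∂x, ∂y) = 1`). -/
def wedge {p q : ℕ} (α : V [⋀^Fin p]→ₗ[ℝ] ℝ) (β : V [⋀^Fin q]→ₗ[ℝ] ℝ) :
    V [⋀^Fin (p + q)]→ₗ[ℝ] ℝ :=
  ((LinearMap.mul' ℝ ℝ).compAlternatingMap (α.domCoprod β)).domDomCongr finSumFinEquiv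

/-- The `k`-th exterior power `α ∧ ⋯ ∧ α` of an alternating `p`-form; the type is right because
`p * (k + 1)` unfolds to `p * k + p`. -/
def wedgePow {p : ℕ} (α : V [⋀^Fin p]→ₗ[ℝ] ℝ) : (k : ℕ) → V [⋀^Fin (p * k)]→ₗ[ℝ] ℝ
  | 0 => AlternatingMap.constOfIsEmpty ℝ V (Fin 0) (1 : ℝ)
  | k + 1 => wedge (wedgePow α k) α

end Linear

section Manifold

variable {d : ℕ} {M : Type*} [TopologicalSpace M] [ChartedSpace (EuclideanSpace ℝ (Fin d)) M]

/-- The coordinate expression of a field `α` of alternating `p`-forms in the preferred chart at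
`x₀`: its pullback under the inverse of the chart. -/
def inChart {p : ℕ} (α : ∀ x : M, TangentSpace (𝓡 d) x [⋀^Fin p]→L[ℝ] ℝ) (x₀ : M)
    (y : EuclideanSpace ℝ (Fin d)) : EuclideanSpace ℝ (Fin d) [⋀^Fin p]→L[ℝ] ℝ :=
  (α ((extChartAt (𝓡 d) x₀).symm y)).compContinuousLinearMap
    (mfderiv 𝓘(ℝ, EuclideanSpace ℝ (Fin d)) (𝓡 d) (extChartAt (𝓡 d) x₀).symm y)

variable (d M) in
/-- A symplectic form on `M`: a smooth, closed, non-degenerate differential `2`-form. -/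
structure SymplecticForm where
  /-- the value of the form at each point -/
  form : ∀ x : M, TangentSpace (𝓡 d) x [⋀^Fin 2]→L[ℝ] ℝ
  smooth : ∀ x₀ : M, ContDiffOn ℝ ∞ (inChart form x₀) (extChartAt (𝓡 d) x₀).target
  closed : ∀ x₀ : M, ∀ y ∈ (extChartAt (𝓡 d) x₀).target, extDeriv (inChart form x₀) y = 0
  nondegenerate : ∀ (x : M) (v : TangentSpace (𝓡 d) x), (∀ w, form x ![v, w] = 0) → v = 0

/-- The field of alternating `2k`-forms `Ω ^ k = Ω ∧ ⋯ ∧ Ω`. -/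
def SymplecticForm.pow (Ω : SymplecticForm d M) (k : ℕ) (x : M) :
    TangentSpace (𝓡 d) x [⋀^Fin (2 * k)]→ₗ[ℝ] ℝ :=
  wedgePow (Ω.form x).toAlternatingMap k

variable (d M) in
/-- Smooth diffeomorphisms of `M`. -/
abbrev Diffeo := M ≃ₘ⟮𝓡 d, 𝓡 d⟯ M

/-- Diffeomorphisms form a group, with `f * g = f ∘ g`. -/
instance : Group (Diffeo d M) where
  one := Diffeomorph.refl (𝓡 d) M ∞
  mul f g := g.trans f
  inv f := f.symm
  mul_assoc _ _ _ := rfl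
  one_mul _ := Diffeomorph.ext fun _ => rfl
  mul_one _ := Diffeomorph.ext fun _ => rfl
  inv_mul_cancel f := Diffeomorph.ext fun x => f.symm_apply_apply x

theorem mul_apply (f g : Diffeo d M) (x : M) : (f * g) x = f (g x) := rfl

theorem one_apply (x : M) : (1 : Diffeo d M) x = x := rfl

theorem mfderiv_mul (f g : Diffeo d M) (x : M) :
    mfderiv (𝓡 d) (𝓡 d) (f * g) x =
      (mfderiv (𝓡 d) (𝓡 d) f (g x)).comp (mfderiv (𝓡 d) (𝓡 d) g x) :=
  mfderiv_comp x ((f.contMDiff.mdifferentiable (by simp)) _)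
    ((g.contMDiff.mdifferentiable (by simp)) _)

theorem mfderiv_one (x : M) :
    mfderiv (𝓡 d) (𝓡 d) (1 : Diffeo d M) x = ContinuousLinearMap.id ℝ _ :=
  mfderiv_id

/-- The pullback at `x` of a field of alternating forms under a diffeomorphism. -/
def pullback {p : ℕ} (f : Diffeo d M) (α : ∀ x : M, TangentSpace (𝓡 d) x [⋀^Fin p]→ₗ[ℝ] ℝ)
    (x : M) : TangentSpace (𝓡 d) x [⋀^Fin p]→ₗ[ℝ] ℝ :=
  (α (f x)).compLinearMap (mfderiv (𝓡 d) (𝓡 d) f x).toLinearMap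

theorem pullback_one {p : ℕ} (α : ∀ x : M, TangentSpace (𝓡 d) x [⋀^Fin p]→ₗ[ℝ] ℝ) :
    pullback 1 α = α := by
  funext x
  ext v
  simp only [pullback, mfderiv_one]
  rfl

theorem pullback_mul {p : ℕ} (f g : Diffeo d M)
    (α : ∀ x : M, TangentSpace (𝓡 d) x [⋀^Fin p]→ₗ[ℝ] ℝ) :
    pullback (f * g) α = pullback g (pullback f α) := by
  funext x
  ext v
  simp only [pullback, mfderiv_mul]
  rfl

/-- `Diff(M, α)`: the group of diffeomorphisms `f` with `f^* α = α`. -/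
def diffPreserving {p : ℕ} (α : ∀ x : M, TangentSpace (𝓡 d) x [⋀^Fin p]→ₗ[ℝ] ℝ) :
    Subgroup (Diffeo d M) where
  carrier := {f | pullback f α = α}
  one_mem' := pullback_one α
  mul_mem' {f g} hf hg := by
    simp only [mem_ofPred_eq] at hf hg ⊢
    rw [pullback_mul, hf, hg]
  inv_mem' {f} hf := by
    simp only [mem_ofPred_eq] at hf ⊢
    calc pullback f⁻¹ α = pullback f⁻¹ (pullback f α) := by rw [hf]
      _ = α := by rw [← pullback_mul, mul_inv_cancel, pullback_one]

/-- `F` restricted to `[0, 1]` is a smooth family of diffeomorphisms: `(t, x) ↦ F t x` is smooth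
on `[0, 1] × M`. -/
def IsSmoothIsotopy (F : ℝ → Diffeo d M) : Prop :=
  ContMDiffOn (𝓘(ℝ, ℝ).prod (𝓡 d)) (𝓡 d) ∞ (fun q : ℝ × M => F q.1 q.2) (Icc 0 1 ×ˢ univ)

/-- The identity component of a group `H` of diffeomorphisms: the elements that are joined to the
identity by a smooth isotopy that stays in `H`. -/
def identityComponent (H : Subgroup (Diffeo d M)) : Subgroup (Diffeo d M) where
  carrier := {f | ∃ F : ℝ → Diffeo d M,
    IsSmoothIsotopy F ∧ (∀ t ∈ Icc (0 : ℝ) 1, F t ∈ H) ∧ F 0 = 1 ∧ F 1 = f}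
  one_mem' := ⟨fun _ => 1, contMDiff_snd.contMDiffOn, fun _ _ => H.one_mem, rfl, rfl⟩
  mul_mem' := by
    rintro f g ⟨F, hF, hFH, hF0, hF1⟩ ⟨G, hG, hGH, hG0, hG1⟩
    refine ⟨fun t => F t * G t, ?_, fun t ht => H.mul_mem (hFH t ht) (hGH t ht), ?_, ?_⟩
    · exact hF.comp (contMDiff_fst.contMDiffOn.prodMk hG) fun q hq => ⟨hq.1, mem_univ _⟩
    · simp only [hF0, hG0, mul_one]
    · simp only [hF1, hG1]
  inv_mem' := by
    rintro f ⟨F, hF, hFH, hF0, hF1⟩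
    have hmem : ∀ t ∈ Icc (0 : ℝ) 1, 1 - t ∈ Icc (0 : ℝ) 1 := fun t ht =>
      ⟨by linarith [ht.2], by linarith [ht.1]⟩
    refine ⟨fun t => F (1 - t) * f⁻¹, ?_, fun t ht => H.mul_mem (hFH _ (hmem t ht))
      (H.inv_mem (hF1 ▸ hFH 1 ⟨zero_le_one, le_rfl⟩)), ?_, ?_⟩
    · have h1 : ContMDiff (𝓘(ℝ, ℝ).prod (𝓡 d)) 𝓘(ℝ, ℝ) ∞ (fun q : ℝ × M => 1 - q.1) :=
        (contDiff_const.sub contDiff_id).contMDiff.comp contMDiff_fst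
      have h2 : ContMDiff (𝓘(ℝ, ℝ).prod (𝓡 d)) (𝓡 d) ∞ (fun q : ℝ × M => f⁻¹ q.2) :=
        (f⁻¹ : Diffeo d M).contMDiff.comp contMDiff_snd
      exact hF.comp (h1.prodMk h2).contMDiffOn fun q hq => ⟨hmem _ hq.1, mem_univ _⟩
    · simp only [sub_zero, hF1, mul_inv_cancel]
    · simp only [sub_self, hF0, one_mul]

/-- `Symp₀(M, Ω)`. -/
def symp₀ (Ω : SymplecticForm d M) : Subgroup (Diffeo d M) :=
  identityComponent (diffPreserving fun x => (Ω.form x).toAlternatingMap)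

/-- `G_k = Diff₀(M, Ω ^ k)`. -/
def diff₀ (Ω : SymplecticForm d M) (k : ℕ) : Subgroup (Diffeo d M) :=
  identityComponent (diffPreserving (Ω.pow k))

end Manifold

end SymplecticPower

end

namespace SymplecticPower

section Linear

/-! Pulling back commutes with wedge powers, so symplectic isotopies preserve `Ω ^ k`. Conversely, a
nondegenerate `α` is determined up to sign by `α ^ k` when `2k` is less than the dimension
(`eq_or_eq_neg_of_wedgePow_eq`). Indeed, if `β ^ k = α ^ k` and `β (u, v) = 0 ≠ α (u, v)`, then
inside the kernel of `β (u, ·)` the pair `u, v` extends to `k` hyperbolic pairs of `α`. There `α ^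
k` is nonzero, while `β ^ k` vanishes because `u` is `β`-orthogonal to all the vectors. Hence `α = c
• β`, and `c ^ k = 1` forces `c = ±1`. Along an isotopy the sign cannot jump: `(F t)^* Ω` is
continuous in `t` and starts at `Ω`. -/

theorem update_pair_snd {V : Type*} (u w v : V) : Function.update ![u, w] 1 v = ![u, v] := by
  ext i
  fin_cases i <;> rfl

variable {V : Type*} [AddCommGroup V] [Module ℝ V]

/-- The bilinear form `(u, v) ↦ α (u, v)` of an alternating `2`-form. -/
noncomputable def toBilin (α : V [⋀^Fin 2]→ₗ[ℝ] ℝ) : V →ₗ[ℝ] V →ₗ[ℝ] ℝ :=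
  LinearMap.mk₂ ℝ (fun u v => α ![u, v])
    (fun u u' v => by simpa using α.map_vecCons_add ![v] u u')
    (fun c u v => by simpa using α.map_vecCons_smul ![v] c u)
    (fun u v v' => by simpa only [update_pair_snd] using α.map_update_add ![u, 0] 1 v v')
    (fun c u v => by simpa only [update_pair_snd] using α.map_update_smul ![u, 0] 1 c v)

theorem toBilin_apply (α : V [⋀^Fin 2]→ₗ[ℝ] ℝ) (u v : V) : toBilin α u v = α ![u, v] := rfl

theorem toBilin_self (α : V [⋀^Fin 2]→ₗ[ℝ] ℝ) (u : V) : toBilin α u u = 0 :=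
  α.map_eq_zero_of_eq ![u, u] (i := 0) (j := 1) rfl (by decide)

theorem toBilin_injective {α β : V [⋀^Fin 2]→ₗ[ℝ] ℝ} (h : toBilin α = toBilin β) : α = β := by
  ext v
  have := LinearMap.congr_fun₂ h (v 0) (v 1)
  rw [toBilin_apply, toBilin_apply] at this
  convert this using 2 <;> (ext i; fin_cases i <;> rfl)

/-! ### Powers of 2-forms as signed sums over permutations -/

/-- The (non-alternating) `k`-th tensor power of a `2`-form. -/
noncomputable def tensorPow (α : V [⋀^Fin 2]→ₗ[ℝ] ℝ) :
    (k : ℕ) → MultilinearMap ℝ (fun _ : Fin (2 * k) => V) ℝ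
  | 0 => MultilinearMap.constOfIsEmpty ℝ (fun _ : Fin 0 => V) 1
  | k + 1 => ((LinearMap.mul' ℝ ℝ).compMultilinearMap
      ((tensorPow α k).domCoprod α.toMultilinearMap)).domDomCongr finSumFinEquiv

/-- The indexing of `Fin (2 * k)` by `k` consecutive pairs. -/
def pairEquiv (k : ℕ) : Fin k × Fin 2 ≃ Fin (2 * k) :=
  finProdFinEquiv.trans (finCongr (mul_comm k 2))

theorem tensorPow_apply (α : V [⋀^Fin 2]→ₗ[ℝ] ℝ) (k : ℕ) (v : Fin (2 * k) → V) :
    tensorPow α k v =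
      ∏ i : Fin k, toBilin α (v (pairEquiv k (i, 0))) (v (pairEquiv k (i, 1))) := by
  induction k with
  | zero => simp [tensorPow]
  | succ k ih =>
    rw [Fin.prod_univ_castSucc]
    change tensorPow α k (fun i => v (finSumFinEquiv (Sum.inl i))) *
      α (fun i => v (finSumFinEquiv (Sum.inr i))) = _
    rw [ih]
    congr 1
    rw [toBilin_apply]
    congr 1
    ext i
    fin_cases i <;> simp [pairEquiv] <;> (congr 1; ext; simp [add_comm])

/-- Alternatization carries tensor products to shuffle products, and each alternating factor `α`
alternatizes to `2 • α`. -/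
theorem two_pow_smul_wedgePow (α : V [⋀^Fin 2]→ₗ[ℝ] ℝ) (k : ℕ) :
    (2 ^ k : ℝ) • wedgePow α k = MultilinearMap.alternatization (tensorPow α k) := by
  induction k with
  | zero =>
    ext v
    simp [wedgePow, tensorPow, MultilinearMap.alternatization_apply]
  | succ k ih =>
    have h2 : (2 : ℝ) • α = MultilinearMap.alternatization α.toMultilinearMap := by
      rw [AlternatingMap.coe_alternatization]
      ext v
      simp [two_mul]
    have key := MultilinearMap.domCoprod_alternization (tensorPow α k) α.toMultilinearMap
    rw [← ih, ← h2, ← AlternatingMap.domCoprod'_apply, ← TensorProduct.smul_tmul',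
      TensorProduct.tmul_smul, map_smul, map_smul, AlternatingMap.domCoprod'_apply,
      smul_smul, ← pow_succ] at key
    ext v
    have hv := congrArg (LinearMap.mul' ℝ ℝ) (DFunLike.congr_fun key (v ∘ finSumFinEquiv))
    rw [AlternatingMap.smul_apply, map_smul, MultilinearMap.alternatization_apply, map_sum] at hv
    rw [AlternatingMap.smul_apply, MultilinearMap.alternatization_apply]
    refine hv.symm.trans ?_
    refine Fintype.sum_equiv finSumFinEquiv.permCongr _ _ fun σ => ?_
    rw [Equiv.Perm.sign_permCongr]
    simp only [Units.smul_def, map_zsmul]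
    congr 1
    simp only [tensorPow, MultilinearMap.domDomCongr_apply,
      LinearMap.compMultilinearMap_apply, Equiv.permCongr_apply, Equiv.symm_apply_apply,
      Function.comp_apply]
    rfl

/-- Up to a power of two, `α ^ k` is the signed sum over all permutations of the products of the
values of `α` on consecutive pairs. -/
theorem two_pow_mul_wedgePow_apply (α : V [⋀^Fin 2]→ₗ[ℝ] ℝ) (k : ℕ) (w : Fin k × Fin 2 → V) :
    2 ^ k * wedgePow α k (w ∘ (pairEquiv k).symm) =
      ∑ σ : Equiv.Perm (Fin k × Fin 2), ((Equiv.Perm.sign σ : ℤ) : ℝ) *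
        ∏ i : Fin k, toBilin α (w (σ (i, 0))) (w (σ (i, 1))) := by
  have h := DFunLike.congr_fun (two_pow_smul_wedgePow α k) (w ∘ (pairEquiv k).symm)
  rw [AlternatingMap.smul_apply, smul_eq_mul, MultilinearMap.alternatization_apply] at h
  rw [h]
  symm
  refine Fintype.sum_equiv (pairEquiv k).permCongr _ _ fun σ => ?_
  rw [Equiv.Perm.sign_permCongr, MultilinearMap.domDomCongr_apply, tensorPow_apply,
    Units.smul_def, zsmul_eq_mul]
  simp [Equiv.permCongr_apply]

theorem wedgePow_compLinearMap {W : Type*} [AddCommGroup W] [Module ℝ W]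
    (α : V [⋀^Fin 2]→ₗ[ℝ] ℝ) (A : W →ₗ[ℝ] V) (k : ℕ) :
    wedgePow (α.compLinearMap A) k = (wedgePow α k).compLinearMap A := by
  ext v
  obtain ⟨w, rfl⟩ : ∃ w : Fin k × Fin 2 → W, v = w ∘ (pairEquiv k).symm :=
    ⟨v ∘ pairEquiv k, by ext; simp⟩
  have h1 := two_pow_mul_wedgePow_apply (α.compLinearMap A) k w
  have h2 := two_pow_mul_wedgePow_apply α k (A ∘ w)
  have h3 : ∀ u v, toBilin (α.compLinearMap A) u v = toBilin α (A u) (A v) := fun u v => by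
    simp only [toBilin_apply, AlternatingMap.compLinearMap_apply]
    congr 1
    ext i
    fin_cases i <;> rfl
  simp only [h3] at h1
  exact mul_left_cancel₀ (pow_ne_zero k two_ne_zero) (h1.trans h2.symm)

theorem toBilin_swap (α : V [⋀^Fin 2]→ₗ[ℝ] ℝ) (u v : V) : toBilin α v u = -toBilin α u v := by
  have h := toBilin_self α (u + v)
  simp only [map_add, LinearMap.add_apply, toBilin_self] at h
  linarith

/-- Every product in the permutation sum has a factor pairing `w p` with some `w q`. -/
theorem wedgePow_eq_zero_of_mem_ker (α : V [⋀^Fin 2]→ₗ[ℝ] ℝ) (k : ℕ) (w : Fin k × Fin 2 → V)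
    (p : Fin k × Fin 2) (hp : ∀ q, toBilin α (w p) (w q) = 0) :
    wedgePow α k (w ∘ (pairEquiv k).symm) = 0 := by
  have h : 2 ^ k * wedgePow α k (w ∘ (pairEquiv k).symm) = 0 := by
    rw [two_pow_mul_wedgePow_apply]
    refine Finset.sum_eq_zero fun σ _ => ?_
    rw [Finset.prod_eq_zero (Finset.mem_univ (σ.symm p).1), mul_zero]
    obtain ⟨⟨i, b⟩, rfl⟩ := σ.surjective p
    rw [Equiv.symm_apply_apply]
    fin_cases b
    · exact hp _
    · rw [toBilin_swap]
      exact neg_eq_zero.mpr (hp _)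
  exact (mul_eq_zero.mp h).resolve_left (by positivity)

/-! ### Hyperbolic pairs -/

/-- A family of `k` pairwise orthogonal hyperbolic pairs of a bilinear form. -/
structure IsHyperbolic (B : V →ₗ[ℝ] V →ₗ[ℝ] ℝ) {k : ℕ} (w : Fin k × Fin 2 → V) : Prop where
  pair : ∀ i, B (w (i, 0)) (w (i, 1)) = 1
  orthogonal : ∀ p q, p.1 ≠ q.1 → B (w p) (w q) = 0

theorem exists_perm_decomposition {k : ℕ} (σ : Equiv.Perm (Fin k × Fin 2))
    (h : ∀ i, (σ (i, 0)).1 = (σ (i, 1)).1) :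
    ∃ (τ : Equiv.Perm (Fin k)) (ε : Fin k → Equiv.Perm (Fin 2)),
      σ = (Equiv.prodCongrLeft fun _ => τ) * Equiv.prodCongrRight ε := by
  have hfst : ∀ i b, (σ (i, b)).1 = (σ (i, 0)).1 := fun i b => by
    fin_cases b
    exacts [rfl, (h i).symm]
  have hτ : Function.Surjective fun i => (σ (i, 0)).1 := fun j => by
    obtain ⟨⟨i, b⟩, hi⟩ := σ.surjective (j, 0)
    exact ⟨i, (hfst i b).symm.trans (congrArg Prod.fst hi)⟩
  have hε : ∀ i, Function.Injective fun b => (σ (i, b)).2 := fun i b b' hb => by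
    have : σ (i, b) = σ (i, b') := Prod.ext ((hfst i b).trans (hfst i b').symm) hb
    exact (Prod.ext_iff.mp (σ.injective this)).2
  refine ⟨Equiv.ofBijective _ (Finite.surjective_iff_bijective.mp hτ),
    fun i => Equiv.ofBijective _ (Finite.injective_iff_bijective.mp (hε i)), ?_⟩
  ext ⟨i, b⟩ : 1
  exact Prod.ext (hfst i b) rfl

theorem IsHyperbolic.toBilin_perm {α : V [⋀^Fin 2]→ₗ[ℝ] ℝ} {k : ℕ} {w : Fin k × Fin 2 → V}
    (hw : IsHyperbolic (toBilin α) w) (i : Fin k) (ε : Equiv.Perm (Fin 2)) :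
    toBilin α (w (i, ε 0)) (w (i, ε 1)) = ((Equiv.Perm.sign ε : ℤ) : ℝ) := by
  have hε : ∀ ε : Equiv.Perm (Fin 2), ε = 1 ∨ ε = Equiv.swap 0 1 := by decide
  obtain rfl | rfl := hε ε
  · simp [hw.pair]
  · simp [toBilin_swap α (w (i, 0)), hw.pair]

/-- No cancellation occurs in the permutation sum. A permutation that breaks up a pair contributes
0. Any other permutes the pairs and swaps inside them; its sign is the product of the signs of the
inner swaps, since the permutation of pairs acts on two copies, so it contributes 1. -/
theorem IsHyperbolic.wedgePow_ne_zero {α : V [⋀^Fin 2]→ₗ[ℝ] ℝ} {k : ℕ} {w : Fin k × Fin 2 → V}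
    (hw : IsHyperbolic (toBilin α) w) : wedgePow α k (w ∘ (pairEquiv k).symm) ≠ 0 := by
  have h : 0 < 2 ^ k * wedgePow α k (w ∘ (pairEquiv k).symm) := by
    rw [two_pow_mul_wedgePow_apply]
    refine Finset.sum_pos' (fun σ _ => ?_) ⟨1, Finset.mem_univ _, by simp [hw.pair]⟩
    by_cases hσ : ∀ i, (σ (i, 0)).1 = (σ (i, 1)).1
    · obtain ⟨τ, ε, rfl⟩ := exists_perm_decomposition σ hσ
      have hprod : ∏ i, toBilin α
          (w (((Equiv.prodCongrLeft fun _ => τ) * Equiv.prodCongrRight ε : Equiv.Perm _) (i, 0)))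
          (w (((Equiv.prodCongrLeft fun _ => τ) * Equiv.prodCongrRight ε : Equiv.Perm _) (i, 1))) =
          ((∏ i, Equiv.Perm.sign (ε i) : ℤˣ) : ℤ) := by
        push_cast
        exact Finset.prod_congr rfl fun i _ => hw.toBilin_perm (τ i) (ε i)
      rw [hprod, Equiv.Perm.sign_mul, Equiv.Perm.sign_prodCongrRight,
        Equiv.Perm.sign_prodCongrLeft, Fin.prod_univ_two, Int.units_mul_self, one_mul,
        ← Int.cast_mul, ← Units.val_mul, Int.units_mul_self]
      simp
    · push Not at hσ
      obtain ⟨i, hi⟩ := hσ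
      rw [Finset.prod_eq_zero (Finset.mem_univ i) (hw.orthogonal _ _ hi), mul_zero]
  exact fun h0 => by simp [h0] at h

/-- The radical of the restriction of a bilinear form to a subspace. -/
def radical (B : V →ₗ[ℝ] V →ₗ[ℝ] ℝ) (X : Submodule ℝ V) : Submodule ℝ V where
  carrier := {x | x ∈ X ∧ ∀ y ∈ X, B x y = 0}
  zero_mem' := ⟨X.zero_mem, by simp⟩
  add_mem' {a b} ha hb := ⟨X.add_mem ha.1 hb.1, fun y hy => by simp [ha.2 y hy, hb.2 y hy]⟩
  smul_mem' c a ha := ⟨X.smul_mem c ha.1, fun y hy => by simp [ha.2 y hy]⟩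

/-- The vectors of `X` that are orthogonal to `e` and `f`. -/
def orthogonalPair (B : V →ₗ[ℝ] V →ₗ[ℝ] ℝ) (X : Submodule ℝ V) (e f : V) : Submodule ℝ V :=
  X ⊓ LinearMap.ker (B e) ⊓ LinearMap.ker (B f)

theorem finrank_le_finrank_inf_ker [FiniteDimensional ℝ V] (X : Submodule ℝ V) (l : V →ₗ[ℝ] ℝ) :
    Module.finrank ℝ X ≤ Module.finrank ℝ (X ⊓ LinearMap.ker l : Submodule ℝ V) + 1 := by
  have h1 := Submodule.finrank_sup_add_finrank_inf_eq X (LinearMap.ker l)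
  have h2 := l.finrank_range_add_finrank_ker
  have h3 : Module.finrank ℝ (LinearMap.range l) ≤ 1 :=
    (Submodule.finrank_le _).trans (by simp)
  have h4 := Submodule.finrank_le (X ⊔ LinearMap.ker l)
  omega

theorem finrank_le_finrank_orthogonalPair [FiniteDimensional ℝ V] (B : V →ₗ[ℝ] V →ₗ[ℝ] ℝ)
    (X : Submodule ℝ V) (e f : V) :
    Module.finrank ℝ X ≤ Module.finrank ℝ (orthogonalPair B X e f) + 2 := by
  have h1 := finrank_le_finrank_inf_ker X (B e)
  have h2 := finrank_le_finrank_inf_ker (X ⊓ LinearMap.ker (B e)) (B f)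
  rw [orthogonalPair]
  omega

theorem radical_orthogonalPair_le (α : V [⋀^Fin 2]→ₗ[ℝ] ℝ) {X : Submodule ℝ V} {e f : V}
    (he : e ∈ X) (hf : f ∈ X) (hef : toBilin α e f = 1) :
    radical (toBilin α) (orthogonalPair (toBilin α) X e f) ≤ radical (toBilin α) X := by
  rintro x ⟨⟨⟨hxX, hxe⟩, hxf⟩, hx⟩
  refine ⟨hxX, fun y hy => ?_⟩
  have hxe' : toBilin α x e = 0 := by rw [toBilin_swap, LinearMap.mem_ker.mp hxe, neg_zero]
  have hxf' : toBilin α x f = 0 := by rw [toBilin_swap, LinearMap.mem_ker.mp hxf, neg_zero]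
  have hfe : toBilin α f e = -1 := by rw [toBilin_swap, hef]
  -- This is the projection of `y` to the orthogonal complement of the hyperbolic pair; `x` pairs
  -- equally with both.
  have hz := hx (y - toBilin α e y • f + toBilin α f y • e)
    ⟨⟨X.add_mem (X.sub_mem hy (X.smul_mem _ hf)) (X.smul_mem _ he), by
      simp [toBilin_self, hef]⟩, by simp [toBilin_self, hfe]⟩
  simpa [hxe', hxf'] using hz

theorem IsHyperbolic.cons {α : V [⋀^Fin 2]→ₗ[ℝ] ℝ} {X : Submodule ℝ V} {e f : V}
    (hef : toBilin α e f = 1) {k : ℕ} {w : Fin k × Fin 2 → V} (hw : IsHyperbolic (toBilin α) w)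
    (hwX : ∀ p, w p ∈ orthogonalPair (toBilin α) X e f) :
    IsHyperbolic (toBilin α)
      (fun p : Fin (k + 1) × Fin 2 => Fin.cases (![e, f] p.2) (fun i => w (i, p.2)) p.1) := by
  have h0 : ∀ (b : Fin 2) p, toBilin α (![e, f] b) (w p) = 0 := fun b p => by
    fin_cases b
    exacts [(hwX p).1.2, (hwX p).2]
  constructor
  · intro i
    cases i using Fin.cases with
    | zero => simpa using hef
    | succ i => simpa using hw.pair i
  · rintro ⟨i, b⟩ ⟨j, c⟩ hij
    cases i using Fin.cases with
    | zero =>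
      cases j using Fin.cases with
      | zero => exact absurd rfl hij
      | succ j => exact h0 b (j, c)
    | succ i =>
      cases j using Fin.cases with
      | zero =>
        rw [toBilin_swap]
        exact neg_eq_zero.mpr (h0 c (i, b))
      | succ j => exact hw.orthogonal (i, b) (j, c) fun h => hij (congrArg Fin.succ h)

/-- Symplectic Gram–Schmidt: splitting off a pair lowers the dimension by at most 2 and does not
enlarge the radical, so the bound passes to the complement. -/
theorem exists_isHyperbolic [FiniteDimensional ℝ V] (α : V [⋀^Fin 2]→ₗ[ℝ] ℝ) (k : ℕ) :
    ∀ X : Submodule ℝ V,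
      Module.finrank ℝ (radical (toBilin α) X) + 2 * k ≤ Module.finrank ℝ X →
      ∃ w : Fin k × Fin 2 → V, IsHyperbolic (toBilin α) w ∧ ∀ p, w p ∈ X := by
  induction k with
  | zero => exact fun X _ => ⟨fun p => p.1.elim0, ⟨fun i => i.elim0, fun p => p.1.elim0⟩,
      fun p => p.1.elim0⟩
  | succ k ih =>
    intro X hX
    obtain ⟨e, he, f, hf, hef⟩ : ∃ e ∈ X, ∃ f ∈ X, toBilin α e f ≠ 0 := by
      by_contra! h
      have : radical (toBilin α) X = X := le_antisymm (fun x hx => hx.1) fun x hx => ⟨hx, h x hx⟩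
      rw [this] at hX
      omega
    have hf' : (toBilin α e f)⁻¹ • f ∈ X := X.smul_mem _ hf
    have hef' : toBilin α e ((toBilin α e f)⁻¹ • f) = 1 := by simp [hef]
    have h1 := finrank_le_finrank_orthogonalPair (toBilin α) X e ((toBilin α e f)⁻¹ • f)
    have h2 := Submodule.finrank_mono (radical_orthogonalPair_le α he hf' hef')
    obtain ⟨w, hw, hwX⟩ := ih (orthogonalPair (toBilin α) X e ((toBilin α e f)⁻¹ • f)) (by omega)
    refine ⟨_, hw.cons hef' hwX, ?_⟩
    rintro ⟨i, b⟩
    cases i using Fin.cases with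
    | zero => fin_cases b; exacts [he, hf']
    | succ i => exact (hwX (i, b)).1.1

/-! ### Recovering a 2-form from its power -/

/-- For `x` in the radical, `B x` vanishes on the kernel of `l`, hence is a multiple of `l`. -/
theorem finrank_radical_ker_le [FiniteDimensional ℝ V] {B : V →ₗ[ℝ] V →ₗ[ℝ] ℝ}
    (hB : Function.Injective B) (l : V →ₗ[ℝ] ℝ) :
    Module.finrank ℝ (radical B (LinearMap.ker l)) ≤ 1 := by
  have hle : (radical B (LinearMap.ker l)).map B ≤ Submodule.span ℝ {l} := by
    rintro _ ⟨x, hx, rfl⟩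
    have := mem_span_of_iInf_ker_le_ker (ι := Unit) (L := fun _ => l) (K := B x)
      (fun y hy => hx.2 y (by simpa using hy))
    simpa using this
  rw [(Submodule.equivMapOfInjective B hB _).finrank_eq]
  exact (Submodule.finrank_mono hle).trans ((finrank_span_le_card {l}).trans (by simp))

theorem toBilin_eq_zero_of_wedgePow_eq [FiniteDimensional ℝ V] {α β : V [⋀^Fin 2]→ₗ[ℝ] ℝ} {k : ℕ}
    (hk : 0 < k) (hdim : 2 * k + 2 ≤ Module.finrank ℝ V) (hα : Function.Injective (toBilin α))
    (h : wedgePow α k = wedgePow β k) {u v : V} (huv : toBilin β u v = 0) :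
    toBilin α u v = 0 := by
  by_contra hne
  obtain ⟨k, rfl⟩ := Nat.exists_eq_succ_of_ne_zero hk.ne'
  have hu : u ∈ LinearMap.ker (toBilin β u) := toBilin_self β u
  have hv : (toBilin α u v)⁻¹ • v ∈ LinearMap.ker (toBilin β u) :=
    Submodule.smul_mem _ _ huv
  have huv' : toBilin α u ((toBilin α u v)⁻¹ • v) = 1 := by simp [hne]
  have h1 := finrank_le_finrank_orthogonalPair (toBilin α) (LinearMap.ker (toBilin β u)) u
    ((toBilin α u v)⁻¹ • v)
  have h2 := Submodule.finrank_mono (radical_orthogonalPair_le α hu hv huv')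
  have h3 := finrank_radical_ker_le hα (toBilin β u)
  have h4 := finrank_le_finrank_inf_ker ⊤ (toBilin β u)
  rw [top_inf_eq, finrank_top] at h4
  -- With exponent `k + 1`, the hyperplane has dimension at least `2k + 3`; removing the pair leaves
  -- at least `2k + 1`, and the radical takes at most 1. This is exactly enough for `k` more pairs.
  obtain ⟨w, hw, hwX⟩ := exists_isHyperbolic α k
    (orthogonalPair (toBilin α) (LinearMap.ker (toBilin β u)) u ((toBilin α u v)⁻¹ • v)) (by omega)
  refine (hw.cons huv' hwX).wedgePow_ne_zero ?_
  rw [h]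
  refine wedgePow_eq_zero_of_mem_ker β (k + 1) _ (0, 0) ?_
  rintro ⟨i, b⟩
  cases i using Fin.cases with
  | zero => fin_cases b; exacts [hu, hv]
  | succ i => exact (hwX (i, b)).1.1

/-- Each `α (u, ·)` is a multiple `c u` of `β (u, ·)`. Antisymmetry gives `c u = c v` when `α (u, v)
≠ 0`, and any two nonzero vectors have a common vector orthogonal to neither. -/
theorem exists_eq_smul_of_ker_le [FiniteDimensional ℝ V] {α β : V [⋀^Fin 2]→ₗ[ℝ] ℝ}
    (hα : Function.Injective (toBilin α))
    (h : ∀ u v, toBilin β u v = 0 → toBilin α u v = 0) : ∃ c : ℝ, α = c • β := by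
  have hc : ∀ u, ∃ c : ℝ, toBilin α u = c • toBilin β u := fun u => by
    have := mem_span_of_iInf_ker_le_ker (ι := Unit) (L := fun _ => toBilin β u)
      (K := toBilin α u) (fun y hy => h u y (by simpa using hy))
    simp only [Set.range_const, Submodule.mem_span_singleton] at this
    exact this.imp fun c hc => hc.symm
  choose c hc using hc
  have hswap : ∀ u v, toBilin α u v ≠ 0 → c u = c v := fun u v huv => by
    have h1 : toBilin α u v = c u * toBilin β u v := by simp [hc u]
    have h2 : toBilin α v u = c v * toBilin β v u := by simp [hc v]
    rw [toBilin_swap α u, toBilin_swap β u, h1] at h2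
    have : toBilin β u v ≠ 0 := fun h0 => huv (h u v h0)
    exact mul_right_cancel₀ this (by linarith)
  have hconst : ∀ u u', u ≠ 0 → u' ≠ 0 → c u = c u' := fun u u' hu hu' => by
    have hne : ∀ x, x ≠ 0 → ∃ y, toBilin α x y ≠ 0 := fun x hx => by
      by_contra! h0
      exact hx (hα (by ext y; simp [h0 y]))
    obtain ⟨y, hy⟩ := hne u hu
    obtain ⟨y', hy'⟩ := hne u' hu'
    by_cases h1 : toBilin α u' y = 0
    · by_cases h2 : toBilin α u y' = 0
      · have h3 := hswap u (y + y') (by simpa [h2] using hy)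
        have h4 := hswap u' (y + y') (by simpa [h1] using hy')
        rw [h3, h4]
      · rw [hswap u y' h2, hswap u' y' hy']
    · rw [hswap u y hy, hswap u' y h1]
  by_cases hV : ∃ u₀ : V, u₀ ≠ 0
  · obtain ⟨u₀, hu₀⟩ := hV
    refine ⟨c u₀, toBilin_injective ?_⟩
    ext u v
    by_cases hu : u = 0
    · simp [hu]
    · rw [hc u, hconst u u₀ hu hu₀]
      rfl
  · push Not at hV
    refine ⟨1, toBilin_injective ?_⟩
    ext u v
    simp [hV u]

theorem wedgePow_smul (c : ℝ) (α : V [⋀^Fin 2]→ₗ[ℝ] ℝ) (k : ℕ) :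
    wedgePow (c • α) k = c ^ k • wedgePow α k := by
  induction k with
  | zero => simp [wedgePow]
  | succ k ih =>
    rw [wedgePow, ih]
    ext v
    simp only [wedge, wedgePow, AlternatingMap.domDomCongr_apply,
      LinearMap.compAlternatingMap_apply, AlternatingMap.smul_apply]
    rw [← AlternatingMap.domCoprod'_apply, ← TensorProduct.smul_tmul', TensorProduct.tmul_smul,
      map_smul, map_smul, AlternatingMap.domCoprod'_apply]
    simp [pow_succ, mul_assoc]

/-- A nondegenerate `2`-form is determined up to sign by its `k`-th power, if `2k` is less than the
dimension. -/
theorem eq_or_eq_neg_of_wedgePow_eq [FiniteDimensional ℝ V] {α β : V [⋀^Fin 2]→ₗ[ℝ] ℝ} {k : ℕ}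
    (hk : 0 < k) (hdim : 2 * k + 2 ≤ Module.finrank ℝ V) (hα : Function.Injective (toBilin α))
    (h : wedgePow α k = wedgePow β k) : β = α ∨ β = -α := by
  obtain ⟨c, hc⟩ := exists_eq_smul_of_ker_le hα
    fun u v => toBilin_eq_zero_of_wedgePow_eq hk hdim hα h
  have hrad : Module.finrank ℝ (radical (toBilin α) ⊤) = 0 := by
    rw [Submodule.finrank_eq_zero, eq_bot_iff]
    exact fun x hx => hα (by ext y; simp [hx.2 y trivial])
  obtain ⟨w, hw, -⟩ := exists_isHyperbolic α k ⊤ (by rw [hrad, finrank_top]; omega)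
  have hne := hw.wedgePow_ne_zero
  have hpow : c ^ k = 1 := by
    have h1 : wedgePow α k = c ^ k • wedgePow α k := by
      conv_lhs => rw [hc, wedgePow_smul, ← h]
    have h2 := DFunLike.congr_fun h1 (w ∘ (pairEquiv k).symm)
    rw [AlternatingMap.smul_apply, smul_eq_mul] at h2
    exact mul_right_cancel₀ hne (by linarith)
  have habs : |c| = (1 : ℝ) :=
    (pow_eq_one_iff_of_nonneg (abs_nonneg c) hk.ne').mp (by rw [← abs_pow, hpow, abs_one])
  rcases eq_or_eq_neg_of_abs_eq habs with h1 | h1 <;> rw [h1] at hc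
  · left; simp [hc]
  · right; rw [hc]; module

end Linear

end SymplecticPower

namespace SymplecticPower

/-! ### Isotopies and continuity of the sign -/

section Manifold

variable {d : ℕ} {M : Type*} [TopologicalSpace M] [ChartedSpace (EuclideanSpace ℝ (Fin d)) M]

theorem symp₀_le_diff₀ (Ω : SymplecticForm d M) (k : ℕ) : symp₀ Ω ≤ diff₀ Ω k := by
  rintro f ⟨F, hF, hFk, hF0, hF1⟩
  refine ⟨F, hF, fun t ht => ?_, hF0, hF1⟩
  funext x
  refine (wedgePow_compLinearMap _ _ _).symm.trans ?_
  exact congrArg (wedgePow · k) (congrFun (hFk t ht) x)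

variable [IsManifold (𝓡 d) ∞ M]

theorem inChart_mfderiv {p : ℕ} (α : ∀ x : M, TangentSpace (𝓡 d) x [⋀^Fin p]→L[ℝ] ℝ) {x₀ x : M}
    (hx : x ∈ (extChartAt (𝓡 d) x₀).source) (v : Fin p → TangentSpace (𝓡 d) x) :
    inChart α x₀ (extChartAt (𝓡 d) x₀ x)
      (fun i => mfderiv (𝓡 d) 𝓘(ℝ, EuclideanSpace ℝ (Fin d)) (extChartAt (𝓡 d) x₀) x (v i)) =
      α x v := by
  have : IsManifold (𝓡 d) 1 M := IsManifold.of_le (n := ∞) (by simp)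
  have h := mfderivWithin_extChartAt_symm_comp_mfderiv_extChartAt' (I := 𝓡 d) hx
  have hr : range (𝓡 d) = univ := by simp
  rw [hr, mfderivWithin_univ] at h
  have h' : ∀ w : TangentSpace (𝓡 d) x,
      (mfderiv 𝓘(ℝ, EuclideanSpace ℝ (Fin d)) (𝓡 d) (extChartAt (𝓡 d) x₀).symm
        (extChartAt (𝓡 d) x₀ x) : EuclideanSpace ℝ (Fin d) →L[ℝ] EuclideanSpace ℝ (Fin d))
        (mfderiv (𝓡 d) 𝓘(ℝ, EuclideanSpace ℝ (Fin d)) (extChartAt (𝓡 d) x₀) x w) = w :=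
    fun w => DFunLike.congr_fun h w
  have hs := (extChartAt (𝓡 d) x₀).left_inv hx
  -- Moves the base point, which equals `x` only propositionally, without rewriting in dependent
  -- types.
  have hα : ∀ y, y = x → ∀ w : Fin p → EuclideanSpace ℝ (Fin d), α y w = α x w := by
    rintro _ rfl w
    rfl
  refine (hα _ hs _).trans ?_
  exact congrArg (α x) (funext fun i => h' (v i))

/-- Near `t₀`, the chart at `b t₀` turns the form and both vector fields into continuous curves in
fixed vector spaces. -/
theorem continuousOn_form (Ω : SymplecticForm d M) {s : Set ℝ} {b : ℝ → M}
    {V W : ∀ t, TangentSpace (𝓡 d) (b t)}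
    (hV : ContinuousOn (fun t => (⟨b t, V t⟩ : TangentBundle (𝓡 d) M)) s)
    (hW : ContinuousOn (fun t => (⟨b t, W t⟩ : TangentBundle (𝓡 d) M)) s) :
    ContinuousOn (fun t => Ω.form (b t) ![V t, W t]) s := by
  have : IsManifold (𝓡 d) 1 M := IsManifold.of_le (n := ∞) (by simp)
  intro t₀ ht₀
  have hb : ContinuousWithinAt b s t₀ :=
    (FiberBundle.continuous_proj (EuclideanSpace ℝ (Fin d)) (TangentSpace (𝓡 d))).continuousAt
      |>.comp_continuousWithinAt (hV t₀ ht₀)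
  have hsrc : ∀ᶠ t in nhdsWithin t₀ s, b t ∈ (chartAt (EuclideanSpace ℝ (Fin d)) (b t₀)).source :=
    hb ((chartAt _ (b t₀)).open_source.mem_nhds (mem_chart_source _ _))
  have hfib : ∀ U : ∀ t, TangentSpace (𝓡 d) (b t),
      ContinuousOn (fun t => (⟨b t, U t⟩ : TangentBundle (𝓡 d) M)) s →
      ContinuousWithinAt (fun t => (mfderiv (𝓡 d) 𝓘(ℝ, EuclideanSpace ℝ (Fin d))
        (extChartAt (𝓡 d) (b t₀)) (b t) (U t) : EuclideanSpace ℝ (Fin d))) s t₀ := by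
    intro U hU
    have h1 := ((FiberBundle.continuousWithinAt_totalSpace (EuclideanSpace ℝ (Fin d)) _).mp
      (hU t₀ ht₀)).2
    have heq : ∀ t, b t ∈ (chartAt (EuclideanSpace ℝ (Fin d)) (b t₀)).source →
        (mfderiv (𝓡 d) 𝓘(ℝ, EuclideanSpace ℝ (Fin d))
        (extChartAt (𝓡 d) (b t₀)) (b t) (U t) : EuclideanSpace ℝ (Fin d)) =
        (trivializationAt (EuclideanSpace ℝ (Fin d)) (TangentSpace (𝓡 d)) (b t₀)
          (⟨b t, U t⟩ : TangentBundle (𝓡 d) M)).2 := fun t ht => by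
      rw [← TangentBundle.continuousLinearMapAt_trivializationAt ht]
      exact Bundle.Trivialization.continuousLinearMapAt_apply_of_mem ℝ
        (trivializationAt (EuclideanSpace ℝ (Fin d)) (TangentSpace (𝓡 d) (M := M)) (b t₀))
        (by simpa using ht) (U t)
    exact h1.congr_of_eventuallyEq (hsrc.mono heq) (heq t₀ (mem_chart_source _ _))
  have hform : ContinuousWithinAt (fun t => inChart Ω.form (b t₀) (extChartAt (𝓡 d) (b t₀) (b t)))
      s t₀ := by
    have h1 : ContinuousAt (inChart Ω.form (b t₀)) (extChartAt (𝓡 d) (b t₀) (b t₀)) :=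
      (Ω.smooth (b t₀)).continuousOn.continuousAt (extChartAt_target_mem_nhds (b t₀))
    exact Filter.Tendsto.comp h1
      ((continuousAt_extChartAt (I := 𝓡 d) (b t₀)).comp_continuousWithinAt hb)
  have hev : ContinuousWithinAt (fun t => inChart Ω.form (b t₀) (extChartAt (𝓡 d) (b t₀) (b t))
      ![mfderiv (𝓡 d) 𝓘(ℝ, EuclideanSpace ℝ (Fin d)) (extChartAt (𝓡 d) (b t₀)) (b t) (V t),
        mfderiv (𝓡 d) 𝓘(ℝ, EuclideanSpace ℝ (Fin d)) (extChartAt (𝓡 d) (b t₀)) (b t) (W t)])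
      s t₀ := by
    refine ContinuousWithinAt.eval hform (continuousWithinAt_pi.mpr fun i => ?_)
    fin_cases i
    exacts [hfib V hV, hfib W hW]
  have heq : ∀ t, b t ∈ (chartAt (EuclideanSpace ℝ (Fin d)) (b t₀)).source →
      Ω.form (b t) ![V t, W t] = inChart Ω.form (b t₀) (extChartAt (𝓡 d) (b t₀) (b t))
      ![mfderiv (𝓡 d) 𝓘(ℝ, EuclideanSpace ℝ (Fin d)) (extChartAt (𝓡 d) (b t₀)) (b t) (V t),
        mfderiv (𝓡 d) 𝓘(ℝ, EuclideanSpace ℝ (Fin d)) (extChartAt (𝓡 d) (b t₀)) (b t) (W t)] := by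
    intro t ht
    rw [← inChart_mfderiv Ω.form (x₀ := b t₀) (by simpa using ht) ![V t, W t]]
    congr 1
    ext i : 1
    fin_cases i <;> rfl
  exact hev.congr_of_eventuallyEq (hsrc.mono heq) (heq t₀ (mem_chart_source _ _))

theorem continuousOn_mfderiv {F : ℝ → Diffeo d M} (hF : IsSmoothIsotopy F) (x : M)
    (u : TangentSpace (𝓡 d) x) :
    ContinuousOn (fun t => (⟨F t x, mfderiv (𝓡 d) (𝓡 d) (F t) x u⟩ : TangentBundle (𝓡 d) M))
      (Icc 0 1) := by
  have : IsManifold (𝓡 d) 1 M := IsManifold.of_le (n := ∞) (by simp)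
  have hu : UniqueMDiffOn (𝓘(ℝ, ℝ).prod (𝓡 d)) (Icc (0 : ℝ) 1 ×ˢ (univ : Set M)) :=
    (uniqueDiffOn_Icc zero_lt_one).uniqueMDiffOn.prod uniqueMDiffOn_univ
  have hT := hF.continuousOn_tangentMapWithin (by simp) hu
  have hzero : Continuous fun t : ℝ => (⟨t, 0⟩ : TangentBundle 𝓘(ℝ, ℝ) ℝ) :=
    (Bundle.contMDiff_zeroSection (n := 0) (IB := 𝓘(ℝ, ℝ)) ℝ (TangentSpace 𝓘(ℝ, ℝ) (M := ℝ))).continuous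
  -- The tangent map of `(t, x) ↦ F t x`, applied to `u` with zero time component, is the derivative
  -- of `F t` alone.
  have hlift : Continuous fun t : ℝ =>
      (equivTangentBundleProd 𝓘(ℝ, ℝ) ℝ (𝓡 d) M).symm (⟨t, 0⟩, ⟨x, u⟩) :=
    (contMDiff_equivTangentBundleProd_symm (n := 0)).continuous.comp
      (hzero.prodMk continuous_const)
  refine (hT.comp hlift.continuousOn fun t ht => ⟨ht, mem_univ _⟩).congr fun t ht => ?_
  have hFt : MDifferentiableWithinAt (𝓘(ℝ, ℝ).prod (𝓡 d)) (𝓡 d)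
      (fun q : ℝ × M => F q.1 q.2) (Icc (0 : ℝ) 1 ×ˢ (univ : Set M)) (t, x) :=
    (hF (t, x) ⟨ht, mem_univ _⟩).mdifferentiableWithinAt (by simp)
  have hinc : MDifferentiableAt (𝓡 d) (𝓘(ℝ, ℝ).prod (𝓡 d)) (fun y : M => (t, y)) x :=
    mdifferentiableAt_const.prodMk mdifferentiableAt_id
  have hcomp := mfderivWithin_comp (I := 𝓡 d) x (f := fun y : M => (t, y)) (s := univ) hFt
    hinc.mdifferentiableWithinAt (fun y _ => ⟨ht, mem_univ _⟩) (uniqueMDiffWithinAt_univ _)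
  rw [mfderivWithin_univ, mfderivWithin_univ, mfderiv_prod_right] at hcomp
  exact congrArg (Bundle.TotalSpace.mk (F t x)) (DFunLike.congr_fun hcomp u)

theorem diff₀_le_symp₀ {n k : ℕ} (hk : 0 < k) (hkn : k < n)
    {M : Type*} [TopologicalSpace M] [ChartedSpace (EuclideanSpace ℝ (Fin (2 * n))) M]
    [IsManifold (𝓡 (2 * n)) ∞ M] (Ω : SymplecticForm (2 * n) M) : diff₀ Ω k ≤ symp₀ Ω := by
  rintro f ⟨F, hF, hFk, hF0, hF1⟩
  refine ⟨F, hF, fun t ht => ?_, hF0, hF1⟩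
  funext x
  set α := (Ω.form x).toAlternatingMap with hα
  set β : ℝ → TangentSpace (𝓡 (2 * n)) x [⋀^Fin 2]→ₗ[ℝ] ℝ :=
    fun t => pullback (F t) (fun x => (Ω.form x).toAlternatingMap) x with hβ
  have hinj : Function.Injective (toBilin α) := by
    refine (injective_iff_map_eq_zero _).mpr fun v hv => Ω.nondegenerate x v fun w => ?_
    exact LinearMap.congr_fun hv w
  have : FiniteDimensional ℝ (TangentSpace (𝓡 (2 * n)) x) :=
    inferInstanceAs (FiniteDimensional ℝ (EuclideanSpace ℝ (Fin (2 * n))))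
  have hdim : 2 * k + 2 ≤ Module.finrank ℝ (TangentSpace (𝓡 (2 * n)) x) := by
    have : Module.finrank ℝ (TangentSpace (𝓡 (2 * n)) x) = 2 * n :=
      finrank_euclideanSpace_fin (𝕜 := ℝ) (n := 2 * n)
    omega
  have hsign : ∀ t ∈ Icc (0 : ℝ) 1, β t = α ∨ β t = -α := fun t ht => by
    refine eq_or_eq_neg_of_wedgePow_eq hk hdim hinj ?_
    exact (congrFun (hFk t ht) x).symm.trans (wedgePow_compLinearMap _ _ _).symm
  obtain ⟨u, v, huv⟩ : ∃ u v, toBilin α u v ≠ 0 := by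
    by_contra! h
    have : Nontrivial (TangentSpace (𝓡 (2 * n)) x) :=
      Module.nontrivial_of_finrank_pos (R := ℝ) (by omega)
    obtain ⟨u, hu⟩ := exists_ne (0 : TangentSpace (𝓡 (2 * n)) x)
    exact hu (hinj (by ext v; simp [h u v]))
  have hcont : ContinuousOn (fun t => toBilin (β t) u v) (Icc 0 1) := by
    refine (continuousOn_form Ω (continuousOn_mfderiv hF x u)
      (continuousOn_mfderiv hF x v)).congr fun t _ => ?_
    refine congrArg (Ω.form (F t x)) (funext fun i => ?_)
    fin_cases i <;> rfl
  have h0 : β 0 = α := by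
    simp only [hβ, hF0, pullback_one]
    rfl
  refine (hsign t ht).resolve_right fun hneg => ?_
  -- A flipped sign at time `t` would make the value on `(u, v)` vanish at some intermediate time,
  -- but it is always `±α (u, v) ≠ 0`.
  have hmem : (0 : ℝ) ∈ uIcc (toBilin (β 0) u v) (toBilin (β t) u v) := by
    rw [h0, hneg]
    change (0 : ℝ) ∈ uIcc (toBilin α u v) (-toBilin α u v)
    rw [mem_uIcc]
    rcases le_total 0 (toBilin α u v) with h | h
    · exact Or.inr ⟨neg_nonpos.mpr h, h⟩
    · exact Or.inl ⟨h, neg_nonneg.mpr h⟩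
  have hsub : uIcc 0 t ⊆ Icc (0 : ℝ) 1 := by
    rw [uIcc_of_le ht.1]
    exact Icc_subset_Icc_right ht.2
  obtain ⟨s, hs, hs0⟩ := intermediate_value_uIcc (hcont.mono hsub) hmem
  rcases hsign s (hsub hs) with h | h
  · exact huv (by simpa only [h] using hs0)
  · simp only [h] at hs0
    exact huv (neg_eq_zero.mp hs0)

end Manifold

end SymplecticPower

theorem mainTheorem3 {n k : ℕ} (hn : 3 ≤ n) (hk : 0 < k) (hkn : k < n)
    {M : Type*} [TopologicalSpace M] [T2Space M] [CompactSpace M] [ConnectedSpace M]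
    [ChartedSpace (EuclideanSpace ℝ (Fin (2 * n))) M] [IsManifold (𝓡 (2 * n)) ∞ M]
    (Ω : SymplecticPower.SymplecticForm (2 * n) M) :
    SymplecticPower.diff₀ Ω k = SymplecticPower.symp₀ Ω :=
  le_antisymm (SymplecticPower.diff₀_le_symp₀ hk hkn Ω) (SymplecticPower.symp₀_le_diff₀ Ω k)
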